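/- Let $\mathbb{E}:\Delta^{op}\to\mathbf{Cat}$ be a simplicial category, with categories $\mathbb{E}_n$, faces $d_i$, and iterated degeneracy $s^n:\mathbb{E}_0\to\mathbb{E}_n$ (induced by $[n]\to[0]$). For $n\ge 1$ call a family of maps $(f^i)_{0\le i\le n}$ of $\mathbb{E}_{n-1}$ *coherent* if $d_if^j=d_{j-1}f^i$ for all $i<j$ (no condition if $n=1$). Assume that $\mathbb{E}$ is a *higher equipment*: for every $n\ge1$, $x\in\mathbb{E}_n$ and coherent family $f^i:d_ix\to y^i$ there are $y\in\mathbb{E}_n$ and $f:x\to y$ with $d_iy=y^i$, $d_if=f^i$ for all $i$, such that for each $h:x\to z$ in $\mathbb{E}_n$ and each coherent family $g^i:y^i\to d_iz$ with $d_ih=g^if^i$ there is a unique $g:y\to z$ with $gf=h$ and $d_ig=g^i$. (Such an $f$ is called a universal extension of $(f^i)$.) *Companions.* For a chain $\sigma=(x_0\xrightarrow{f_1}x_1\to\cdots\xrightarrow{f_n}x_n)$ in $\mathbb{E}_0$ the companion $\sigma^*\in\mathbb{E}_n$ and the map $\varphi_\sigma:s^nx_0\to\sigma^*$ are defined recursively: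 for $n=0$, $\sigma^*=x_0$ and $\varphi_\sigma=1$; for $n>0$, $\varphi_\sigma$ is a chosen universal extension of the family given by $\varphi_{d_i\sigma}:s^{n-1}x_0\to(d_i\sigma)^*$ for $i>0$ and $\varphi_{d_0\sigma}\circ s^{n-1}f_1$ for $i=0$. Then $d_i\sigma^*=(d_i\sigma)^*$, and there are unique comparison maps $\psi_\theta:(\theta\sigma)^*\to\theta(\sigma^*)$, for $\theta:[m]\to[n]$ in $\Delta$, which make $(\cdot)^*:\mathbb{E}_0\to\mathbb{E}$ an oplax transformation, are identities for coface maps, and satisfy $\psi_\theta\varphi_{\theta\sigma}=\theta(\varphi_\sigma)$ for codegeneracies. *Double colimits.* A cocone $\eta:D\Rightarrow x$ from an oplax diagram $(D,\psi):\mathcal{J}\to\mathbb{E}$ to $x\in\mathbb{E}_0$ consists of maps $\eta_\sigma:D(\sigma)\to s^nx$ in $\mathbb{E}_n$, one for each $n$-simplex $\sigma$ of the nerve of $\mathcal{J}$, with $\theta(\eta_\sigma)\circ\psi_\theta=\eta_{\theta\sigma}$ for all $\theta$. It exhibits $x$ as the double colimit $\mathrm{dcolim}\,D$ if for every cocone $\eta':D\Rightarrow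 x'$ there is a unique $f:x\to x'$ in $\mathbb{E}_0$ with $s^nf\circ\eta_\sigma=\eta'_\sigma$ for all $\sigma$. *Homotopy colimits.* Let $\mathbb{E}_v$ be the $\mathbf{sSet}$-enriched category with underlying category $\mathbb{E}_0$ and mapping spaces $\mathbb{E}_v(x,y)_n=\mathbb{E}_n(s^nx,s^ny)$. A tensor $K\odot x$ is an object with bijections $\mathbb{E}_0(K\odot x,y)\cong\mathbf{sSet}(K,\mathbb{E}_v(x,y))$ natural in $y$. The homotopy colimit of $F:\mathcal{J}\to\mathbb{E}_0$ is the coend $\mathrm{hocolim}\,F=\int^{i\in\mathcal{J}}N(i/\mathcal{J})\odot F(i)$ in $\mathbb{E}_0$. **Theorem.** Let $\mathcal{J}$ be a small category and $F:\mathcal{J}\to\mathbb{E}_0$ a functor such that the tensors $N(i/\mathcal{J})\odot F(j)$ occurring in the formula for the homotopy colimit exist, and let $F^*$ be the composite $\mathcal{J}\xrightarrow{F}\mathbb{E}_0\xrightarrow{(\cdot)^*}\mathbb{E}$. Then $\mathrm{dcolim}\,F^*$ exists if and only if $\mathrm{hocolim}\,F$ exists, and in that case $$\mathrm{dcolim}\,F^*\cong\mathrm{hocolim}\,F,$$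 by an isomorphism compatible with the structure maps: for every $n$-simplex $\tau=(i\xrightarrow{a}j_0\to\cdots\to j_n)$ of $N(i/\mathcal{J})$ it carries $\eta_{(j_0\to\cdots\to j_n)}\circ\varphi_{F(j_0\to\cdots\to j_n)}\circ s^nF(a)\in\mathbb{E}_v(F(i),\mathrm{dcolim}\,F^*)_n$ to the image of $\tau$ under the map $N(i/\mathcal{J})\to\mathbb{E}_v(F(i),\mathrm{hocolim}\,F)$ that corresponds to the coend inclusion $N(i/\mathcal{J})\odot F(i)\to\mathrm{hocolim}\,F$. -/

import Mathlib

open CategoryTheory Opposite Simplicial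

universe w v u

namespace HigherEquipment

section Basics

variable {C : Type u} [Category.{v} C] {D : Type u} [Category.{v} D]

theorem mk_inj {a b : C} {f g : a ⟶ b} (h : Arrow.mk f = Arrow.mk g) : f = g := by
  have := (Arrow.mk_inj a b).1 h
  exact this

theorem mk_comp_congr {a b c a' b' c' : C} {f : a ⟶ b} {g : b ⟶ c} {f' : a' ⟶ b'} {g' : b' ⟶ c'}
    (hf : Arrow.mk f = Arrow.mk f') (hg : Arrow.mk g = Arrow.mk g') :
    Arrow.mk (f ≫ g) = Arrow.mk (f' ≫ g') := by
  obtain rfl : a = a' := congrArg Comma.left hf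
  obtain rfl : b = b' := congrArg Comma.right hf
  obtain rfl : c = c' := congrArg Comma.right hg
  rw [mk_inj hf, mk_inj hg]

theorem mk_map_congr (F : C ⥤ D) {a b a' b' : C} {f : a ⟶ b} {f' : a' ⟶ b'}
    (hf : Arrow.mk f = Arrow.mk f') : Arrow.mk (F.map f) = Arrow.mk (F.map f') :=
  congrArg F.mapArrow.obj hf

theorem mk_cast {a b a' b' : C} (ha : a' = a) (hb : b = b') (f : a ⟶ b) :
    Arrow.mk (eqToHom ha ≫ f ≫ eqToHom hb) = Arrow.mk f := by
  subst ha hb; simp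

theorem mk_cast_left {a b a' : C} (ha : a' = a) (f : a ⟶ b) :
    Arrow.mk (eqToHom ha ≫ f) = Arrow.mk f := by
  subst ha; simp

theorem mk_cast_right {a b b' : C} (hb : b = b') (f : a ⟶ b) :
    Arrow.mk (f ≫ eqToHom hb) = Arrow.mk f := by
  subst hb; simp

theorem mk_id_comp {a b c d : C} {f : a ⟶ b} (hf : Arrow.mk f = Arrow.mk (𝟙 c)) (g : b ⟶ d) :
    Arrow.mk (f ≫ g) = Arrow.mk g := by
  obtain rfl : a = c := congrArg Comma.left hf
  obtain rfl : b = a := congrArg Comma.right hf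
  rw [mk_inj hf, Category.id_comp]

end Basics

variable (E : SimplicialObject Cat.{v, u})

/-- The category `𝔼ₙ` of horizontal `n`-simplices. -/
def Lev (n : ℕ) : Type u := E.obj (op ⦋n⦌)

instance (n : ℕ) : Category.{v} (Lev E n) := (E.obj (op ⦋n⦌)).str

variable {E}

/-- The functor `𝔼ₙ ⥤ 𝔼ₘ` given by `θ : [m] ⟶ [n]`. -/
def pull {m n : ℕ} (θ : ⦋m⦌ ⟶ ⦋n⦌) : Lev E n ⥤ Lev E m := (E.map θ.op).toFunctor

variable (E) in
/-- The iterated degeneracy `sⁿ : 𝔼₀ ⥤ 𝔼ₙ`, induced by the unique map `[n] ⟶ [0]`. -/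
def dg (n : ℕ) : Lev E 0 ⥤ Lev E n := pull (SimplexCategory.const ⦋n⦌ ⦋0⦌ 0)

theorem pull_id_eq (n : ℕ) : (pull (𝟙 ⦋n⦌) : Lev E n ⥤ Lev E n) = 𝟭 _ := by
  unfold pull
  rw [op_id, E.map_id]; rfl

theorem pull_comp_eq {k m n : ℕ} (ω : ⦋k⦌ ⟶ ⦋m⦌) (θ : ⦋m⦌ ⟶ ⦋n⦌) :
    (pull θ ⋙ pull ω : Lev E n ⥤ Lev E k) = pull (ω ≫ θ) := by
  unfold pull
  rw [op_comp, E.map_comp]; rfl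

theorem dg_pull_eq {m n : ℕ} (θ : ⦋m⦌ ⟶ ⦋n⦌) : dg E n ⋙ pull θ = dg E m := by
  unfold dg
  rw [pull_comp_eq, SimplexCategory.eq_const_to_zero (θ ≫ _)]

theorem dg_zero_eq : dg E 0 = 𝟭 _ := by
  unfold dg
  rw [SimplexCategory.const_eq_id, pull_id_eq]

theorem dg_obj_eq {m n : ℕ} (θ : ⦋m⦌ ⟶ ⦋n⦌) (x : Lev E 0) :
    (pull θ).obj ((dg E n).obj x) = (dg E m).obj x :=
  congrArg (fun G : Lev E 0 ⥤ Lev E m => G.obj x) (dg_pull_eq θ)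

theorem dg_zero_obj (x : Lev E 0) : (dg E 0).obj x = x :=
  congrArg (fun G : Lev E 0 ⥤ Lev E 0 => G.obj x) dg_zero_eq

theorem mk_pull_id {n : ℕ} {a b : Lev E n} (f : a ⟶ b) :
    Arrow.mk ((pull (𝟙 ⦋n⦌)).map f) = Arrow.mk f :=
  congrArg (fun G : Lev E n ⥤ Lev E n => Arrow.mk (G.map f)) (pull_id_eq n)

theorem mk_pull_pull {k m n : ℕ} (ω : ⦋k⦌ ⟶ ⦋m⦌) (θ : ⦋m⦌ ⟶ ⦋n⦌) {a b : Lev E n} (f : a ⟶ b) :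
    Arrow.mk ((pull ω).map ((pull θ).map f)) = Arrow.mk ((pull (ω ≫ θ)).map f) :=
  congrArg (fun G : Lev E n ⥤ Lev E k => Arrow.mk (G.map f)) (pull_comp_eq ω θ)

theorem mk_pull_dg {m n : ℕ} (θ : ⦋m⦌ ⟶ ⦋n⦌) {x y : Lev E 0} (f : x ⟶ y) :
    Arrow.mk ((pull θ).map ((dg E n).map f)) = Arrow.mk ((dg E m).map f) :=
  congrArg (fun G : Lev E 0 ⥤ Lev E m => Arrow.mk (G.map f)) (dg_pull_eq θ)

theorem mk_dg_zero {x y : Lev E 0} (f : x ⟶ y) : Arrow.mk ((dg E 0).map f) = Arrow.mk f :=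
  congrArg (fun G : Lev E 0 ⥤ Lev E 0 => Arrow.mk (G.map f)) dg_zero_eq

/-! ### The equipment property -/

/-- A family of arrows `f⁰, …, fⁿ⁺¹` of `𝔼ₙ` is coherent if `dᵢ fʲ = dⱼ₋₁ fⁱ` for all `i < j`
(equality in the set of arrows of `𝔼ₙ₋₁`; no condition if `n = 0`). -/
def Coherent {n : ℕ} (f : Fin (n + 2) → Arrow (Lev E n)) : Prop :=
  match n, f with
  | 0, _ => True
  | n + 1, f => ∀ i j : Fin (n + 2), i ≤ j →
      (pull (SimplexCategory.δ i)).mapArrow.obj (f j.succ) =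
        (pull (SimplexCategory.δ j)).mapArrow.obj (f i.castSucc)

/-- `f : x ⟶ y` is a universal extension of the map of boundaries `fb i : dᵢ x ⟶ yb i`. -/
structure IsUniversalExtension {n : ℕ} {x : Lev E (n + 1)} {yb : Fin (n + 2) → Lev E n}
    (fb : ∀ i, (pull (SimplexCategory.δ i)).obj x ⟶ yb i) {y : Lev E (n + 1)} (f : x ⟶ y) :
    Prop where
  /-- `dᵢ f = fⁱ`, and hence `dᵢ y = yⁱ` -/
  face (i : Fin (n + 2)) :
    Arrow.mk ((pull (SimplexCategory.δ i)).map f) = Arrow.mk (fb i)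
  /-- Any `h : x ⟶ z` whose boundary factors through `f^•` as a map of boundaries factors
  uniquely through `f`, compatibly with the given factorization of the boundary. -/
  factor {z : Lev E (n + 1)} (h : x ⟶ z)
    (gb : ∀ i, yb i ⟶ (pull (SimplexCategory.δ i)).obj z)
    (hg : Coherent fun i => Arrow.mk (gb i))
    (hh : ∀ i, (pull (SimplexCategory.δ i)).map h = fb i ≫ gb i) :
    ∃! g : y ⟶ z, f ≫ g = h ∧
      ∀ i, Arrow.mk ((pull (SimplexCategory.δ i)).map g) = Arrow.mk (gb i)

theorem coherent_faces {n : ℕ} {y z : Lev E (n + 1)} (g : y ⟶ z) :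
    Coherent fun i => Arrow.mk ((pull (SimplexCategory.δ i)).map g) := by
  cases n with
  | zero => trivial
  | succ n =>
    intro i j hij
    refine (mk_pull_pull _ _ g).trans (Eq.trans ?_ (mk_pull_pull _ _ g).symm)
    rw [SimplexCategory.δ_comp_δ hij]

theorem IsUniversalExtension.hom_ext {n : ℕ} {x : Lev E (n + 1)} {yb : Fin (n + 2) → Lev E n}
    {fb : ∀ i, (pull (SimplexCategory.δ i)).obj x ⟶ yb i} {y : Lev E (n + 1)} {f : x ⟶ y}
    (hf : IsUniversalExtension fb f) {z : Lev E (n + 1)} {k k' : y ⟶ z} (h : f ≫ k = f ≫ k')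
    (hh : ∀ i, (pull (SimplexCategory.δ i)).map k = (pull (SimplexCategory.δ i)).map k') :
    k = k' := by
  have e (i) : yb i = (pull (SimplexCategory.δ i)).obj y :=
    (congrArg Comma.right (hf.face i)).symm
  have e' (i) : Arrow.mk (eqToHom (e i) ≫ (pull (SimplexCategory.δ i)).map k) =
    Arrow.mk ((pull (SimplexCategory.δ i)).map k) := mk_cast_left _ _
  refine (hf.factor (f ≫ k) (fun i => eqToHom (e i) ≫ (pull (SimplexCategory.δ i)).map k)
    ?_ ?_).unique ⟨rfl, fun i => (e' i).symm⟩ ⟨h.symm, fun i => ?_⟩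
  · simp only [e']
    exact coherent_faces k
  · intro i
    apply mk_inj
    rw [CategoryTheory.Functor.map_comp]
    exact mk_comp_congr (hf.face i) (e' i).symm
  · rw [← hh i]; exact (e' i).symm

variable (E) in
/-- A higher equipment: every coherent map out of the boundary of a simplex extends
universally. -/
def IsHigherEquipment : Prop :=
  ∀ (n : ℕ) (x : Lev E (n + 1)) (yb : Fin (n + 2) → Lev E n)
    (fb : ∀ i, (pull (SimplexCategory.δ i)).obj x ⟶ yb i),
    (Coherent fun i => Arrow.mk (fb i)) →
      ∃ (y : Lev E (n + 1)) (f : x ⟶ y), IsUniversalExtension fb f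

/-! ### Companions -/

/-- The simplicial operator `θ` acting on an `n`-simplex of (the nerve of) a category. -/
def reindex {J : Type*} [Category J] {m n : ℕ} (θ : ⦋m⦌ ⟶ ⦋n⦌) (σ : ComposableArrows J n) :
    ComposableArrows J m :=
  (nerve J).map θ.op σ

theorem reindex_comp {J : Type*} [Category J] {k m n : ℕ} (ω : ⦋k⦌ ⟶ ⦋m⦌) (θ : ⦋m⦌ ⟶ ⦋n⦌)
    (σ : ComposableArrows J n) : reindex ω (reindex θ σ) = reindex (ω ≫ θ) σ := rfl

theorem reindex_id {J : Type*} [Category J] {n : ℕ}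
    (σ : ComposableArrows J n) : reindex (𝟙 ⦋n⦌) σ = σ := rfl

/-- The map from the first vertex of `σ` to the first vertex of `θ(σ)`. -/
def first {J : Type*} [Category J] {m n : ℕ} (θ : ⦋m⦌ ⟶ ⦋n⦌) (σ : ComposableArrows J n) :
    σ.obj 0 ⟶ (reindex θ σ).obj 0 :=
  σ.map (homOfLE (Fin.zero_le (θ.toOrderHom 0)))

theorem first_comp {J : Type*} [Category J] {k m n : ℕ} (ω : ⦋k⦌ ⟶ ⦋m⦌) (θ : ⦋m⦌ ⟶ ⦋n⦌)
    (σ : ComposableArrows J n) :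
    first θ σ ≫ first ω (reindex θ σ) = first (ω ≫ θ) σ :=
  (σ.map_comp _ _).symm

theorem mk_first_eq_id {J : Type*} [Category J] {m n : ℕ} (θ : ⦋m⦌ ⟶ ⦋n⦌)
    (h : θ.toOrderHom 0 = 0) (σ : ComposableArrows J n) :
    Arrow.mk (first θ σ) = Arrow.mk (𝟙 (σ.obj 0)) := by
  have : ∀ (a : Fin (n + 1)), a = 0 → Arrow.mk (σ.map (homOfLE (Fin.zero_le a))) =
      Arrow.mk (𝟙 (σ.obj 0)) := by
    rintro a rfl
    rw [← σ.map_id]; rfl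
  exact this _ h

/-- The boundary map used in the construction of the companion of `σ = (x₀ ⟶ ⋯ ⟶ xₙ₊₁)`, given
the maps `φ_τ : sⁿ τ₀ ⟶ τ^*` for all `n`-simplices `τ`: it is `φ_{dᵢ σ}` if `i > 0`, and `φ_{d₀ σ}`
precomposed with the image under `sⁿ` of `x₀ ⟶ x₁` if `i = 0`. -/
def companionBoundary {n : ℕ}
    (c : ∀ τ : ComposableArrows (Lev E 0) n, Σ y : Lev E n, (dg E n).obj (τ.obj 0) ⟶ y)
    (σ : ComposableArrows (Lev E 0) (n + 1)) (i : Fin (n + 2)) :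
    (pull (SimplexCategory.δ i)).obj ((dg E (n + 1)).obj (σ.obj 0)) ⟶
      (c (reindex (SimplexCategory.δ i) σ)).1 :=
  eqToHom (dg_obj_eq _ _) ≫
    (dg E n).map (first (SimplexCategory.δ i) σ) ≫ (c (reindex (SimplexCategory.δ i) σ)).2

open Classical in
/-- The companion `σ^*` of a vertical simplex together with `φ_σ : sⁿ x₀ ⟶ σ^*`, by recursion: a
chosen universal extension of the maps `φ_{dᵢ σ}`. The condition in the `if` always holds, see
`companionPair_coherent`. -/
noncomputable def companionPair (hE : IsHigherEquipment E) {n : ℕ}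
    (σ : ComposableArrows (Lev E 0) n) : Σ y : Lev E n, (dg E n).obj (σ.obj 0) ⟶ y :=
  match n, σ with
  | 0, σ => ⟨σ.obj 0, eqToHom (dg_zero_obj _)⟩
  | n + 1, σ =>
    if h : Coherent fun i =>
        Arrow.mk (companionBoundary (fun τ => companionPair hE (n := n) τ) σ i) then
      ⟨_, (hE n _ _ _ h).choose_spec.choose⟩
    else ⟨_, 𝟙 _⟩

section Companion

variable (hE : IsHigherEquipment E)

/-- The companion `σ^*` of `σ`. -/
noncomputable def companion {n : ℕ} (σ : ComposableArrows (Lev E 0) n) : Lev E n :=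
  (companionPair hE σ).1

/-- The structure map `φ_σ : sⁿ x₀ ⟶ σ^*`. -/
noncomputable def phi {n : ℕ} (σ : ComposableArrows (Lev E 0) n) :
    (dg E n).obj (σ.obj 0) ⟶ companion hE σ :=
  (companionPair hE σ).2

theorem mk_phi_zero (σ : ComposableArrows (Lev E 0) 0) :
    Arrow.mk (phi hE σ) = Arrow.mk (𝟙 (σ.obj 0)) := by
  have : Arrow.mk (phi hE σ) = Arrow.mk (eqToHom (dg_zero_obj (σ.obj 0))) := by
    unfold phi companion
    rw [companionPair]
  rw [this]
  have := mk_cast_left (dg_zero_obj (σ.obj 0)) (𝟙 _)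
  rwa [Category.comp_id] at this

theorem mk_companionBoundary {n : ℕ} (σ : ComposableArrows (Lev E 0) (n + 1)) (i : Fin (n + 2)) :
    Arrow.mk (companionBoundary (companionPair hE) σ i) = Arrow.mk ((dg E n).map (first (SimplexCategory.δ i) σ) ≫
        phi hE (reindex (SimplexCategory.δ i) σ)) :=
  mk_cast_left _ _

theorem phi_isUniversalExtension_of_coherent {n : ℕ} (σ : ComposableArrows (Lev E 0) (n + 1))
    (h : Coherent fun i => Arrow.mk (companionBoundary (companionPair hE) σ i)) :
    IsUniversalExtension (companionBoundary (companionPair hE) σ) (phi hE σ) := by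
  have key : companionPair hE σ = ⟨_, (hE n _ _ _ h).choose_spec.choose⟩ := by
    rw [companionPair, dif_pos h]
  unfold phi companion
  rw [key]
  exact (hE n _ _ _ h).choose_spec.choose_spec

theorem companionPair_coherent {n : ℕ} (σ : ComposableArrows (Lev E 0) (n + 1)) :
    Coherent fun i => Arrow.mk (companionBoundary (companionPair hE) σ i) := by
  induction n with
  | zero => trivial
  | succ n ih =>
    have face (τ : ComposableArrows (Lev E 0) (n + 1)) (i : Fin (n + 2)) :=
      ((phi_isUniversalExtension_of_coherent hE τ (ih τ)).face i).trans
        (mk_companionBoundary hE τ i)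
    -- a general double face
    have dbl (i : Fin (n + 2)) (j : Fin (n + 3)) :
        (pull (SimplexCategory.δ i)).mapArrow.obj
          (Arrow.mk (companionBoundary (companionPair hE) σ j)) =
        Arrow.mk ((dg E n).map (first (SimplexCategory.δ i ≫ SimplexCategory.δ j) σ) ≫
          phi hE (reindex (SimplexCategory.δ i ≫ SimplexCategory.δ j) σ)) := by
      rw [mk_companionBoundary]
      change Arrow.mk ((pull (SimplexCategory.δ i)).map (_ ≫ _)) = _
      rw [Functor.map_comp]
      refine (mk_comp_congr (mk_pull_dg _ _) (face _ i)).trans ?_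
      rw [← Category.assoc, ← Functor.map_comp]
      rw [first_comp]
      rfl
    intro i j hij
    rw [dbl, dbl, SimplexCategory.δ_comp_δ hij]

theorem phi_isUniversalExtension {n : ℕ} (σ : ComposableArrows (Lev E 0) (n + 1)) :
    IsUniversalExtension (companionBoundary (companionPair hE) σ) (phi hE σ) :=
  phi_isUniversalExtension_of_coherent hE σ (companionPair_coherent hE σ)

theorem phi_face {n : ℕ} (σ : ComposableArrows (Lev E 0) (n + 1)) (i : Fin (n + 2)) :
    Arrow.mk ((pull (SimplexCategory.δ i)).map (phi hE σ)) = Arrow.mk ((dg E n).map (first (SimplexCategory.δ i) σ) ≫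
        phi hE (reindex (SimplexCategory.δ i) σ)) :=
  ((phi_isUniversalExtension hE σ).face i).trans (mk_companionBoundary hE σ i)

theorem companion_face {n : ℕ} (σ : ComposableArrows (Lev E 0) (n + 1)) (i : Fin (n + 2)) :
    (pull (SimplexCategory.δ i)).obj (companion hE σ) = companion hE (reindex (SimplexCategory.δ i) σ) :=
  congrArg Comma.right (phi_face hE σ i)

theorem comp_σ_comp_δ {m n : ℕ} (θ : ⦋m⦌ ⟶ ⦋n + 1⦌) (h : θ.toOrderHom 0 ≠ 0) :
    (θ ≫ SimplexCategory.σ 0) ≫ SimplexCategory.δ 0 = θ := by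
  obtain ⟨θ', hθ'⟩ := SimplexCategory.eq_comp_δ_of_not_surjective' θ 0 (fun x hx => h (by
    have := θ.toOrderHom.monotone (Fin.zero_le x)
    exact le_antisymm (this.trans hx.le) (Fin.zero_le _)))
  subst hθ'
  have h1 := SimplexCategory.δ_comp_σ_self (i := (0 : Fin (n + 1)))
  rw [Fin.castSucc_zero] at h1
  rw [Category.assoc θ', h1, Category.comp_id]

theorem kappa_aux₁ {m n : ℕ} (θ : ⦋m⦌ ⟶ ⦋n⦌) (σ : ComposableArrows (Lev E 0) n)
    (h : θ.toOrderHom 0 = 0) :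
    (dg E m).obj ((reindex θ σ).obj 0) = (pull θ).obj ((dg E n).obj (σ.obj 0)) := by
  rw [dg_obj_eq]
  exact congrArg (fun a => (dg E m).obj (σ.obj a)) h

theorem kappa_aux₂ {m n : ℕ} (θ : ⦋m⦌ ⟶ ⦋n + 1⦌) (σ : ComposableArrows (Lev E 0) (n + 1))
    (h : θ.toOrderHom 0 ≠ 0) :
    (dg E m).obj ((reindex θ σ).obj 0) = (dg E m).obj
      ((reindex (θ ≫ SimplexCategory.σ 0) (reindex (SimplexCategory.δ 0) σ)).obj 0) := by
  rw [reindex_comp, comp_σ_comp_δ θ h]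

theorem kappa_aux₃ {m n : ℕ} (θ : ⦋m⦌ ⟶ ⦋n + 1⦌) (σ : ComposableArrows (Lev E 0) (n + 1))
    (h : θ.toOrderHom 0 ≠ 0) :
    (pull (θ ≫ SimplexCategory.σ 0)).obj (companion hE (reindex (SimplexCategory.δ 0) σ)) =
      (pull θ).obj (companion hE σ) := by
  have := congrArg (fun G : Lev E (n + 1) ⥤ Lev E m => G.obj (companion hE σ))
    (pull_comp_eq (E := E) (θ ≫ SimplexCategory.σ 0) (SimplexCategory.δ 0))
  rw [comp_σ_comp_δ θ h] at this
  rw [← this, ← companion_face]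
  rfl

/-- The maps `s^m x_{θ(0)} ⟶ θ(σ^*)` for `σ = (x₀ ⟶ ⋯ ⟶ xₙ)` and `θ : [m] ⟶ [n]`: if `θ(0) = 0` it
is `θ(φ_σ)`, and otherwise `θ` factors through the face `d₀ σ`, whose companion is `d₀ (σ^*)`. -/
noncomputable def kappa {m n : ℕ} (θ : ⦋m⦌ ⟶ ⦋n⦌) (σ : ComposableArrows (Lev E 0) n) :
    (dg E m).obj ((reindex θ σ).obj 0) ⟶ (pull θ).obj (companion hE σ) :=
  match n, θ, σ with
  | 0, θ, σ => eqToHom (kappa_aux₁ θ σ (Subsingleton.elim (α := Fin 1) _ _)) ≫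
      (pull θ).map (phi hE σ)
  | _ + 1, θ, σ =>
    if h : θ.toOrderHom 0 = 0 then eqToHom (kappa_aux₁ θ σ h) ≫ (pull θ).map (phi hE σ)
    else eqToHom (kappa_aux₂ θ σ h) ≫
      kappa (θ ≫ SimplexCategory.σ 0) (reindex (SimplexCategory.δ 0) σ) ≫
        eqToHom (kappa_aux₃ hE θ σ h)

theorem mk_kappa_of_zero {m n : ℕ} (θ : ⦋m⦌ ⟶ ⦋n⦌) (σ : ComposableArrows (Lev E 0) n)
    (h : θ.toOrderHom 0 = 0) :
    Arrow.mk (kappa hE θ σ) = Arrow.mk ((pull θ).map (phi hE σ)) := by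
  cases n with
  | zero => rw [kappa]; exact mk_cast_left _ _
  | succ n => rw [kappa, dif_pos h]; exact mk_cast_left _ _

theorem mk_kappa_of_ne {m n : ℕ} (θ : ⦋m⦌ ⟶ ⦋n + 1⦌) (σ : ComposableArrows (Lev E 0) (n + 1))
    (h : θ.toOrderHom 0 ≠ 0) :
    Arrow.mk (kappa hE θ σ) =
      Arrow.mk (kappa hE (θ ≫ SimplexCategory.σ 0) (reindex (SimplexCategory.δ 0) σ)) := by
  rw [kappa, dif_neg h]; exact mk_cast _ _ _

theorem δ_zero_comp_ne {m n : ℕ} (ω : ⦋m⦌ ⟶ ⦋n⦌) :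
    (ω ≫ SimplexCategory.δ (0 : Fin (n + 2))).toOrderHom 0 ≠ 0 :=
  Fin.succAbove_ne 0 _

theorem mk_kappa_comp_δ_zero {m n : ℕ} (ω : ⦋m⦌ ⟶ ⦋n⦌) (σ : ComposableArrows (Lev E 0) (n + 1)) :
    Arrow.mk (kappa hE (ω ≫ SimplexCategory.δ 0) σ) =
      Arrow.mk (kappa hE ω (reindex (SimplexCategory.δ 0) σ)) := by
  have h1 := SimplexCategory.δ_comp_σ_self (i := (0 : Fin (n + 1)))
  rw [Fin.castSucc_zero] at h1
  rw [mk_kappa_of_ne hE _ σ (δ_zero_comp_ne ω), Category.assoc ω, h1, Category.comp_id]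

theorem exists_comp_δ_zero {m n : ℕ} (θ : ⦋m⦌ ⟶ ⦋n + 1⦌) (h : θ.toOrderHom 0 ≠ 0) :
    ∃ ω : ⦋m⦌ ⟶ ⦋n⦌, θ = ω ≫ SimplexCategory.δ 0 :=
  ⟨_, (comp_σ_comp_δ θ h).symm⟩

/-- `θ(φ_σ)` is the composite of `x₀ ⟶ x_{θ(0)}` and `kappa θ σ`. -/
theorem mk_pull_phi {m n : ℕ} (θ : ⦋m⦌ ⟶ ⦋n⦌) (σ : ComposableArrows (Lev E 0) n) :
    Arrow.mk ((pull θ).map (phi hE σ)) =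
      Arrow.mk ((dg E m).map (first θ σ) ≫ kappa hE θ σ) := by
  have zero : ∀ {n : ℕ} (θ : ⦋m⦌ ⟶ ⦋n⦌) (σ : ComposableArrows (Lev E 0) n),
      θ.toOrderHom 0 = 0 → Arrow.mk ((pull θ).map (phi hE σ)) =
      Arrow.mk ((dg E m).map (first θ σ) ≫ kappa hE θ σ) := by
    intro n θ σ h
    rw [mk_id_comp (c := (dg E m).obj (σ.obj 0)), mk_kappa_of_zero hE θ σ h]
    rw [mk_map_congr (dg E m) (mk_first_eq_id θ h σ), CategoryTheory.Functor.map_id]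
  induction n with
  | zero => exact zero θ σ (Subsingleton.elim (α := Fin 1) _ _)
  | succ n ih =>
    by_cases h : θ.toOrderHom 0 = 0
    · exact zero θ σ h
    · obtain ⟨ω, rfl⟩ := exists_comp_δ_zero θ h
      rw [← mk_pull_pull, mk_map_congr (pull ω) (phi_face hE σ 0), Functor.map_comp,
        mk_comp_congr (mk_pull_dg _ _) (ih ω _), ← Category.assoc, ← Functor.map_comp, first_comp]
      exact mk_comp_congr rfl (mk_kappa_comp_δ_zero hE ω σ).symm

theorem mk_kappa_id {n : ℕ} (σ : ComposableArrows (Lev E 0) n) :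
    Arrow.mk (kappa hE (𝟙 _) σ) = Arrow.mk (phi hE σ) :=
  (mk_kappa_of_zero hE (𝟙 _) σ rfl).trans (mk_pull_id _)

theorem mk_pull_kappa {k m n : ℕ} (ω : ⦋k⦌ ⟶ ⦋m⦌) (θ : ⦋m⦌ ⟶ ⦋n⦌)
    (σ : ComposableArrows (Lev E 0) n) :
    Arrow.mk ((pull ω).map (kappa hE θ σ)) =
      Arrow.mk ((dg E k).map (first ω (reindex θ σ)) ≫ kappa hE (ω ≫ θ) σ) := by
  have zero : ∀ {n : ℕ} (θ : ⦋m⦌ ⟶ ⦋n⦌) (σ : ComposableArrows (Lev E 0) n),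
      θ.toOrderHom 0 = 0 → Arrow.mk ((pull ω).map (kappa hE θ σ)) =
      Arrow.mk ((dg E k).map (first ω (reindex θ σ)) ≫ kappa hE (ω ≫ θ) σ) := by
    intro n θ σ h
    rw [mk_map_congr _ (mk_kappa_of_zero hE θ σ h), mk_pull_pull, mk_pull_phi]
    have e : (dg E k).map (first (ω ≫ θ) σ) = (dg E k).map (first θ σ) ≫
        (dg E k).map (first ω (reindex θ σ)) := by
      rw [← CategoryTheory.Functor.map_comp, first_comp]; rfl
    refine (congrArg (fun f => Arrow.mk (f ≫ kappa hE (ω ≫ θ) σ)) e).trans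
      ((congrArg Arrow.mk (Category.assoc _ _ _)).trans ?_)
    refine mk_id_comp (c := (dg E k).obj (σ.obj 0)) ?_ _
    rw [mk_map_congr (dg E k) (mk_first_eq_id θ h σ), CategoryTheory.Functor.map_id]
  induction n with
  | zero => exact zero θ σ (Subsingleton.elim (α := Fin 1) _ _)
  | succ n ih =>
    by_cases h : θ.toOrderHom 0 = 0
    · exact zero θ σ h
    · obtain ⟨θ, rfl⟩ := exists_comp_δ_zero θ h
      rw [mk_map_congr _ (mk_kappa_comp_δ_zero hE θ σ), ih]
      exact mk_comp_congr rfl (mk_kappa_comp_δ_zero hE (ω ≫ θ) σ).symm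

/-- `kappa` is compatible with faces. -/
theorem mk_kappa_face {m n : ℕ} (ω : ⦋m⦌ ⟶ ⦋n⦌) (i : Fin (n + 2))
    (σ : ComposableArrows (Lev E 0) (n + 1)) :
    Arrow.mk (kappa hE ω (reindex (SimplexCategory.δ i) σ)) =
      Arrow.mk (kappa hE (ω ≫ SimplexCategory.δ i) σ) := by
  have zero : ∀ {n : ℕ} (ω : ⦋m⦌ ⟶ ⦋n⦌) (i : Fin (n + 1))
      (σ : ComposableArrows (Lev E 0) (n + 1)), ω.toOrderHom 0 = 0 →
      Arrow.mk (kappa hE ω (reindex (SimplexCategory.δ i.succ) σ)) =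
        Arrow.mk (kappa hE (ω ≫ SimplexCategory.δ i.succ) σ) := by
    intro n ω i σ h
    have hi : (SimplexCategory.δ i.succ).toOrderHom 0 = 0 := Fin.succ_succAbove_zero i
    have h2 : (ω ≫ SimplexCategory.δ i.succ).toOrderHom 0 = 0 := by
      change (SimplexCategory.δ i.succ).toOrderHom (ω.toOrderHom 0) = 0
      rw [h, hi]
    rw [mk_kappa_of_zero hE _ _ h, mk_kappa_of_zero hE _ _ h2, ← mk_pull_pull]
    refine mk_map_congr _ ?_
    rw [phi_face]
    refine (mk_id_comp (c := (dg E n).obj (σ.obj 0)) ?_ _).symm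
    rw [mk_map_congr (dg E n) (mk_first_eq_id _ hi σ), CategoryTheory.Functor.map_id]
  induction n with
  | zero =>
    refine Fin.cases ?_ (fun i => ?_) i
    · exact (mk_kappa_comp_δ_zero hE ω σ).symm
    · exact zero ω i σ (Subsingleton.elim (α := Fin 1) _ _)
  | succ n ih =>
    refine Fin.cases ?_ (fun i => ?_) i
    · exact (mk_kappa_comp_δ_zero hE ω σ).symm
    · by_cases h : ω.toOrderHom 0 = 0
      · exact zero ω i σ h
      · obtain ⟨ω, rfl⟩ := exists_comp_δ_zero ω h
        have h2 := SimplexCategory.δ_comp_δ (Fin.zero_le i)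
        rw [Fin.castSucc_zero] at h2
        have h3 : reindex (SimplexCategory.δ 0) (reindex (SimplexCategory.δ i.succ) σ) =
            reindex (SimplexCategory.δ i) (reindex (SimplexCategory.δ 0) σ) := by
          rw [reindex_comp, h2]; rfl
        rw [mk_kappa_comp_δ_zero, Category.assoc, h2, ← Category.assoc, mk_kappa_comp_δ_zero, h3, ih]

/-- A map out of a companion is determined by its composites with the maps `kappa`. -/
theorem companion_hom_ext {n : ℕ} {σ : ComposableArrows (Lev E 0) n} {z : Lev E n}
    {k k' : companion hE σ ⟶ z}
    (h : ∀ (m : ℕ) (ω : ⦋m⦌ ⟶ ⦋n⦌), kappa hE ω σ ≫ (pull ω).map k = kappa hE ω σ ≫ (pull ω).map k') :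
    k = k' := by
  have hid : phi hE σ ≫ k = phi hE σ ≫ k' := by
    apply mk_inj
    have h0 : ∀ l : companion hE σ ⟶ z, Arrow.mk (phi hE σ ≫ l) =
        Arrow.mk (kappa hE (𝟙 _) σ ≫ (pull (𝟙 _)).map l) := fun l =>
      mk_comp_congr (mk_kappa_id hE σ).symm (mk_pull_id l).symm
    rw [h0, h0, h]
  induction n with
  | zero =>
    have := mk_phi_zero hE σ
    apply mk_inj
    rw [← mk_id_comp this k, ← mk_id_comp this k', hid]
  | succ n ih =>
    have hf (i : Fin (n + 2)) : (pull (SimplexCategory.δ i)).map k =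
        (pull (SimplexCategory.δ i)).map k' := by
      have key (l : companion hE σ ⟶ z) {m : ℕ} (ω : ⦋m⦌ ⟶ ⦋n⦌) :
          Arrow.mk (kappa hE ω (reindex (SimplexCategory.δ i) σ) ≫ (pull ω).map
            (eqToHom (companion_face hE σ i).symm ≫ (pull (SimplexCategory.δ i)).map l)) =
          Arrow.mk (kappa hE (ω ≫ SimplexCategory.δ i) σ ≫
            (pull (ω ≫ SimplexCategory.δ i)).map l) :=
        mk_comp_congr (mk_kappa_face hE ω i σ)
          ((mk_map_congr _ (mk_cast_left _ _)).trans (mk_pull_pull _ _ _))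
      rw [← cancel_epi (eqToHom (companion_face hE σ i).symm)]
      have e : ∀ (m : ℕ) (ω : ⦋m⦌ ⟶ ⦋n⦌),
          kappa hE ω (reindex (SimplexCategory.δ i) σ) ≫ (pull ω).map
            (eqToHom (companion_face hE σ i).symm ≫ (pull (SimplexCategory.δ i)).map k) =
          kappa hE ω (reindex (SimplexCategory.δ i) σ) ≫ (pull ω).map
            (eqToHom (companion_face hE σ i).symm ≫ (pull (SimplexCategory.δ i)).map k') :=
        fun m ω => mk_inj (by rw [key, key, h])
      refine ih e (mk_inj ?_)
      have h0 : ∀ l : companion hE (reindex (SimplexCategory.δ i) σ) ⟶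
          (pull (SimplexCategory.δ i)).obj z,
          Arrow.mk (phi hE (reindex (SimplexCategory.δ i) σ) ≫ l) =
          Arrow.mk (kappa hE (𝟙 _) (reindex (SimplexCategory.δ i) σ) ≫ (pull (𝟙 _)).map l) :=
        fun l => mk_comp_congr (mk_kappa_id hE _).symm (mk_pull_id l).symm
      rw [h0, h0, e]
    exact (phi_isUniversalExtension hE σ).hom_ext hid hf

/-- The universal property of companions: a map `σ^* ⟶ z` is the same as a compatible family of
maps `s^m x_{ω(0)} ⟶ ω(z)`. -/
theorem exists_companion_desc {n : ℕ} (σ : ComposableArrows (Lev E 0) n) (z : Lev E n)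
    (h : ∀ {m : ℕ} (ω : ⦋m⦌ ⟶ ⦋n⦌), (dg E m).obj ((reindex ω σ).obj 0) ⟶ (pull ω).obj z)
    (hh : ∀ {k m : ℕ} (ω' : ⦋k⦌ ⟶ ⦋m⦌) (ω : ⦋m⦌ ⟶ ⦋n⦌), Arrow.mk ((pull ω').map (h ω)) =
      Arrow.mk ((dg E k).map (first ω' (reindex ω σ)) ≫ h (ω' ≫ ω))) :
    ∃ k : companion hE σ ⟶ z, ∀ {m : ℕ} (ω : ⦋m⦌ ⟶ ⦋n⦌), kappa hE ω σ ≫ (pull ω).map k = h ω := by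
  have zero : ∀ {n : ℕ} (σ : ComposableArrows (Lev E 0) n) (z : Lev E n)
      (h : ∀ {m : ℕ} (ω : ⦋m⦌ ⟶ ⦋n⦌), (dg E m).obj ((reindex ω σ).obj 0) ⟶ (pull ω).obj z)
      (_ : ∀ {k m : ℕ} (ω' : ⦋k⦌ ⟶ ⦋m⦌) (ω : ⦋m⦌ ⟶ ⦋n⦌), Arrow.mk ((pull ω').map (h ω)) =
        Arrow.mk ((dg E k).map (first ω' (reindex ω σ)) ≫ h (ω' ≫ ω)))
      (k : companion hE σ ⟶ z) (_ : Arrow.mk (phi hE σ ≫ k) = Arrow.mk (h (𝟙 _)))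
      {m : ℕ} (ω : ⦋m⦌ ⟶ ⦋n⦌) (_ : ω.toOrderHom 0 = 0), kappa hE ω σ ≫ (pull ω).map k = h ω := by
    intro n σ z h hh k hk m ω hω
    apply mk_inj
    have h1 : Arrow.mk (kappa hE ω σ ≫ (pull ω).map k) =
        Arrow.mk ((pull ω).map (phi hE σ ≫ k)) := by
      rw [CategoryTheory.Functor.map_comp]
      exact mk_comp_congr (mk_kappa_of_zero hE ω σ hω) rfl
    rw [h1, mk_map_congr _ hk, hh ω (𝟙 _)]
    refine (mk_id_comp (c := (dg E m).obj (σ.obj 0)) ?_ _).trans ?_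
    · exact (mk_map_congr (dg E m) (mk_first_eq_id ω hω σ)).trans
        (congrArg Arrow.mk ((dg E m).map_id _))
    · exact congrArg (fun w => Arrow.mk (h w)) (Category.comp_id ω)
  induction n with
  | zero =>
    have e1 : (dg E 0).obj (σ.obj 0) = companion hE σ :=
      (congrArg Comma.left (mk_phi_zero hE σ)).trans (congrArg Comma.right (mk_phi_zero hE σ)).symm
    have e2 : (pull (𝟙 ⦋0⦌)).obj z = z :=
      congrArg (fun G : Lev E 0 ⥤ Lev E 0 => G.obj z) (pull_id_eq 0)
    refine ⟨eqToHom e1.symm ≫ h (𝟙 _) ≫ eqToHom e2, fun ω => zero σ z h hh _ ?_ ω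
      (Subsingleton.elim (α := Fin 1) _ _)⟩
    exact (mk_id_comp (mk_phi_zero hE σ) _).trans (mk_cast _ _ _)
  | succ n ih =>
    have ez {m : ℕ} (ω : ⦋m⦌ ⟶ ⦋n⦌) (i : Fin (n + 2)) : (pull (ω ≫ SimplexCategory.δ i)).obj z =
        (pull ω).obj ((pull (SimplexCategory.δ i)).obj z) :=
      congrArg (fun G : Lev E (n + 1) ⥤ Lev E m => G.obj z) (pull_comp_eq _ _).symm
    have ez' : (pull (𝟙 ⦋n + 1⦌)).obj z = z :=
      congrArg (fun G : Lev E (n + 1) ⥤ Lev E (n + 1) => G.obj z) (pull_id_eq _)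
    have step (i : Fin (n + 2)) := ih (reindex (SimplexCategory.δ i) σ)
      ((pull (SimplexCategory.δ i)).obj z)
      (fun ω => h (ω ≫ SimplexCategory.δ i) ≫ eqToHom (ez ω i)) (by
        intro k m ω' ω
        refine (mk_map_congr _ (mk_cast_right _ _)).trans ((hh ω' _).trans ?_)
        exact mk_comp_congr rfl (mk_cast_right _ _).symm)
    choose g hg using step
    have hg' (i : Fin (n + 2)) {m : ℕ} (ω : ⦋m⦌ ⟶ ⦋n⦌) :
        Arrow.mk (kappa hE ω (reindex (SimplexCategory.δ i) σ) ≫ (pull ω).map (g i)) =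
          Arrow.mk (h (ω ≫ SimplexCategory.δ i)) := by
      rw [hg]; exact mk_cast_right _ _
    have hgphi (i : Fin (n + 2)) :
        Arrow.mk (phi hE (reindex (SimplexCategory.δ i) σ) ≫ g i) =
          Arrow.mk (h (SimplexCategory.δ i)) := by
      refine (mk_comp_congr (mk_kappa_id hE _).symm (mk_pull_id _).symm).trans ((hg' i _).trans ?_)
      rw [Category.id_comp (SimplexCategory.δ i)]
    have coh : Coherent fun i => Arrow.mk (g i) := by
      cases n with
      | zero => trivial
      | succ n =>
        intro i j hij
        have hθ := SimplexCategory.δ_comp_δ hij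
        have e : reindex (SimplexCategory.δ i) (reindex (SimplexCategory.δ j.succ) σ) =
          reindex (SimplexCategory.δ j) (reindex (SimplexCategory.δ i.castSucc) σ) := by
          rw [reindex_comp, reindex_comp, hθ]
        have e1 : companion hE (reindex (SimplexCategory.δ i) (reindex (SimplexCategory.δ j.succ) σ)) =
          (pull (SimplexCategory.δ i)).obj (companion hE (reindex (SimplexCategory.δ j.succ) σ)) :=
          (companion_face hE _ _).symm
        have e2 : companion hE (reindex (SimplexCategory.δ i) (reindex (SimplexCategory.δ j.succ) σ)) =
          (pull (SimplexCategory.δ j)).obj (companion hE (reindex (SimplexCategory.δ i.castSucc) σ)) :=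
          (congrArg (companion hE) e).trans (companion_face hE _ _).symm
        have e3 : (pull (SimplexCategory.δ j)).obj ((pull (SimplexCategory.δ i.castSucc)).obj z) =
          (pull (SimplexCategory.δ i)).obj ((pull (SimplexCategory.δ j.succ)).obj z) := by
          have a1 := congrArg (fun G : Lev E (n + 1 + 1) ⥤ Lev E n => G.obj z)
            (pull_comp_eq (E := E) (SimplexCategory.δ j) (SimplexCategory.δ i.castSucc))
          have a2 := congrArg (fun G : Lev E (n + 1 + 1) ⥤ Lev E n => G.obj z)
            (pull_comp_eq (E := E) (SimplexCategory.δ i) (SimplexCategory.δ j.succ))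
          rw [hθ] at a2
          exact a1.trans a2.symm
        have main : eqToHom e1 ≫ (pull (SimplexCategory.δ i)).map (g j.succ) =
            eqToHom e2 ≫ (pull (SimplexCategory.δ j)).map (g i.castSucc) ≫ eqToHom e3 := by
          refine companion_hom_ext hE (fun m ω => mk_inj ?_)
          have b1 : Arrow.mk (kappa hE ω
              (reindex (SimplexCategory.δ i) (reindex (SimplexCategory.δ j.succ) σ)) ≫
                (pull ω).map (eqToHom e1 ≫ (pull (SimplexCategory.δ i)).map (g j.succ))) =
              Arrow.mk (h ((ω ≫ SimplexCategory.δ i) ≫ SimplexCategory.δ j.succ)) :=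
            (mk_comp_congr (mk_kappa_face hE _ _ _) ((mk_map_congr _ (mk_cast_left _ _)).trans
              (mk_pull_pull _ _ _))).trans (hg' j.succ _)
          have b0 : Arrow.mk (kappa hE ω
              (reindex (SimplexCategory.δ i) (reindex (SimplexCategory.δ j.succ) σ))) =
              Arrow.mk (kappa hE ω
              (reindex (SimplexCategory.δ j) (reindex (SimplexCategory.δ i.castSucc) σ))) := by
            congr 1 <;> rw [e]
          have b2 : Arrow.mk (kappa hE ω
              (reindex (SimplexCategory.δ i) (reindex (SimplexCategory.δ j.succ) σ)) ≫
                (pull ω).map (eqToHom e2 ≫ (pull (SimplexCategory.δ j)).map (g i.castSucc) ≫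
                  eqToHom e3)) =
              Arrow.mk (h ((ω ≫ SimplexCategory.δ j) ≫ SimplexCategory.δ i.castSucc)) :=
            (mk_comp_congr (b0.trans (mk_kappa_face hE _ _ _))
              ((mk_map_congr _ (mk_cast _ _ _)).trans
                (mk_pull_pull _ _ _))).trans (hg' i.castSucc _)
          rw [b1, b2, Category.assoc ω, Category.assoc ω, hθ]
        have := congrArg Arrow.mk main
        rwa [mk_cast_left, mk_cast] at this
    obtain ⟨k, ⟨hk1, hk2⟩, -⟩ := (phi_isUniversalExtension hE σ).factor
      (h (𝟙 _) ≫ eqToHom ez') g coh (by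
        intro i
        apply mk_inj
        refine (mk_map_congr _ (mk_cast_right _ _)).trans ((hh _ (𝟙 _)).trans ?_)
        refine Eq.trans ?_ (mk_comp_congr (mk_companionBoundary hE σ i).symm rfl)
        rw [Category.assoc]
        refine mk_comp_congr rfl (Eq.trans ?_ (hgphi i).symm)
        exact congrArg (fun w => Arrow.mk (h w)) (Category.comp_id (SimplexCategory.δ i)))
    refine ⟨k, fun {m} ω => ?_⟩
    by_cases hω : ω.toOrderHom 0 = 0
    · exact zero σ z h hh k (by rw [hk1]; exact mk_cast_right _ _) ω hω
    · obtain ⟨ω, rfl⟩ := exists_comp_δ_zero ω hω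
      apply mk_inj
      exact (mk_comp_congr (mk_kappa_comp_δ_zero hE ω σ)
        ((mk_pull_pull _ _ _).symm.trans (mk_map_congr _ (hk2 0)))).trans (hg' 0 ω)

end Companion

/-! ### Oplax horizontal diagrams and double colimits -/

/-- An oplax horizontal diagram `J ⟶ 𝔼`: an object of `𝔼ₙ` for each `n`-simplex of the nerve of `J`
and structure maps `ψ_θ : D(θ(σ)) ⟶ θ(D(σ))` satisfying the coherence laws. -/
structure OplaxDiagram (J : Type*) [Category J] (E : SimplicialObject Cat.{v, u}) where
  /-- the value on an `n`-simplex -/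
  obj {n : ℕ} (σ : ComposableArrows J n) : Lev E n
  /-- the structure maps -/
  ψ {m n : ℕ} (θ : ⦋m⦌ ⟶ ⦋n⦌) (σ : ComposableArrows J n) :
    obj (reindex θ σ) ⟶ (pull θ).obj (obj σ)
  ψ_id {n : ℕ} (σ : ComposableArrows J n) : Arrow.mk (ψ (𝟙 ⦋n⦌) σ) = Arrow.mk (𝟙 (obj σ))
  ψ_comp {k m n : ℕ} (ω : ⦋k⦌ ⟶ ⦋m⦌) (θ : ⦋m⦌ ⟶ ⦋n⦌) (σ : ComposableArrows J n) :
    Arrow.mk (ψ (ω ≫ θ) σ) = Arrow.mk (ψ ω (reindex θ σ) ≫ (pull ω).map (ψ θ σ))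

namespace OplaxDiagram

/-- The composite of a functor `I ⥤ J` with a diagram `J ⟶ 𝔼`. -/
def precomp {I J : Type*} [Category I] [Category J] (F : I ⥤ J) (D : OplaxDiagram J E) :
    OplaxDiagram I E where
  obj σ := D.obj (σ ⋙ F)
  ψ θ σ := D.ψ θ (σ ⋙ F)
  ψ_id σ := D.ψ_id (σ ⋙ F)
  ψ_comp ω θ σ := D.ψ_comp ω θ (σ ⋙ F)

variable {J : Type*} [Category J]

/-- A transformation `η : D ⇒ x` to the constant diagram at `x ∈ 𝔼₀`. -/
structure Cocone (D : OplaxDiagram J E) (x : Lev E 0) where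
  /-- the component at an `n`-simplex -/
  η {n : ℕ} (σ : ComposableArrows J n) : D.obj σ ⟶ (dg E n).obj x
  naturality {m n : ℕ} (θ : ⦋m⦌ ⟶ ⦋n⦌) (σ : ComposableArrows J n) :
    Arrow.mk (D.ψ θ σ ≫ (pull θ).map (η σ)) = Arrow.mk (η (reindex θ σ))

/-- `η : D ⇒ x` exhibits `x` as the double colimit of `D`. -/
def Cocone.IsDoubleColimit {D : OplaxDiagram J E} {x : Lev E 0} (c : D.Cocone x) : Prop :=
  ∀ (x' : Lev E 0) (c' : D.Cocone x'), ∃! f : x ⟶ x',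
    ∀ (n : ℕ) (σ : ComposableArrows J n), c.η σ ≫ (dg E n).map f = c'.η σ

end OplaxDiagram

section Companion

variable (hE : IsHigherEquipment E)

theorem exists_comparison {m n : ℕ} (θ : ⦋m⦌ ⟶ ⦋n⦌) (σ : ComposableArrows (Lev E 0) n) :
    ∃ c : companion hE (reindex θ σ) ⟶ (pull θ).obj (companion hE σ),
      ∀ {k : ℕ} (ω : ⦋k⦌ ⟶ ⦋m⦌),
        Arrow.mk (kappa hE ω (reindex θ σ) ≫ (pull ω).map c) = Arrow.mk (kappa hE (ω ≫ θ) σ) := by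
  have e {k : ℕ} (ω : ⦋k⦌ ⟶ ⦋m⦌) : (pull (ω ≫ θ)).obj (companion hE σ) =
      (pull ω).obj ((pull θ).obj (companion hE σ)) :=
    congrArg (fun G : Lev E n ⥤ Lev E k => G.obj (companion hE σ)) (pull_comp_eq ω θ).symm
  obtain ⟨c, hc⟩ := exists_companion_desc hE (reindex θ σ) ((pull θ).obj (companion hE σ))
    (fun ω => kappa hE (ω ≫ θ) σ ≫ eqToHom (e ω)) (by
      intro k l ω' ω
      refine (mk_map_congr _ (mk_cast_right _ _)).trans ((mk_pull_kappa hE ω' _ σ).trans ?_)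
      exact mk_comp_congr rfl (mk_cast_right _ _).symm)
  refine ⟨c, fun ω => ?_⟩
  rw [hc]
  exact mk_cast_right _ _

/-- The comparison map `(θ(σ))^* ⟶ θ(σ^*)`: the unique map compatible with the structure maps of
both sides on all faces. It is an identity if `θ` is a coface map (`comparison_face`), and its
composite with `φ_{θ(σ)}` is `θ(φ_σ)` if `θ` is a codegeneracy map (`phi_comparison`). -/
noncomputable def comparison {m n : ℕ} (θ : ⦋m⦌ ⟶ ⦋n⦌) (σ : ComposableArrows (Lev E 0) n) :
    companion hE (reindex θ σ) ⟶ (pull θ).obj (companion hE σ) :=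
  (exists_comparison hE θ σ).choose

theorem mk_kappa_comparison {k m n : ℕ} (ω : ⦋k⦌ ⟶ ⦋m⦌) (θ : ⦋m⦌ ⟶ ⦋n⦌)
    (σ : ComposableArrows (Lev E 0) n) :
    Arrow.mk (kappa hE ω (reindex θ σ) ≫ (pull ω).map (comparison hE θ σ)) =
      Arrow.mk (kappa hE (ω ≫ θ) σ) :=
  (exists_comparison hE θ σ).choose_spec ω

theorem phi_comparison {m n : ℕ} (θ : ⦋m⦌ ⟶ ⦋n⦌) (h : θ.toOrderHom 0 = 0)
    (σ : ComposableArrows (Lev E 0) n) :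
    Arrow.mk (phi hE (reindex θ σ) ≫ comparison hE θ σ) =
      Arrow.mk ((pull θ).map (phi hE σ)) := by
  rw [← mk_kappa_of_zero hE θ σ h]
  refine (mk_comp_congr (mk_kappa_id hE _).symm (mk_pull_id _).symm).trans
    ((mk_kappa_comparison hE (𝟙 _) θ σ).trans ?_)
  rw [Category.id_comp θ]

theorem comparison_face {n : ℕ} (i : Fin (n + 2)) (σ : ComposableArrows (Lev E 0) (n + 1)) :
    comparison hE (SimplexCategory.δ i) σ = eqToHom (companion_face hE σ i).symm := by
  refine companion_hom_ext hE (fun m ω => mk_inj ?_)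
  refine (mk_kappa_comparison hE ω _ σ).trans ((mk_kappa_face hE ω i σ).symm.trans ?_)
  rw [eqToHom_map]
  exact (mk_cast_right _ _).symm

/-- The companion map `(·)^* : 𝔼₀ ⟶ 𝔼`, an oplax transformation. -/
noncomputable def companionDiagram : OplaxDiagram (Lev E 0) E where
  obj σ := companion hE σ
  ψ θ σ := comparison hE θ σ
  ψ_id {n} σ := by
    have e : (pull (𝟙 ⦋n⦌)).obj (companion hE σ) = companion hE σ :=
      congrArg (fun G : Lev E n ⥤ Lev E n => G.obj (companion hE σ)) (pull_id_eq n)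
    have h : comparison hE (𝟙 ⦋n⦌) σ = 𝟙 (companion hE σ) ≫ eqToHom e.symm := by
      refine companion_hom_ext hE (σ := σ) (fun m ω => mk_inj ?_)
      refine (mk_kappa_comparison hE ω (𝟙 _) σ).trans ?_
      rw [Category.id_comp, eqToHom_map, mk_cast_right, Category.comp_id ω]
    rw [h]
    exact mk_cast_right _ _
  ψ_comp {k m n} ω θ σ := by
    have e : (pull ω).obj ((pull θ).obj (companion hE σ)) = (pull (ω ≫ θ)).obj (companion hE σ) :=
      congrArg (fun G : Lev E n ⥤ Lev E k => G.obj (companion hE σ)) (pull_comp_eq ω θ)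
    have h : comparison hE (ω ≫ θ) σ =
        (comparison hE ω (reindex θ σ) ≫ (pull ω).map (comparison hE θ σ)) ≫ eqToHom e := by
      refine companion_hom_ext hE (σ := reindex (ω ≫ θ) σ) (fun l ρ => mk_inj ?_)
      refine (mk_kappa_comparison hE ρ (ω ≫ θ) σ).trans ?_
      have h1 := mk_kappa_comparison hE ρ ω (reindex θ σ)
      have h2 := mk_kappa_comparison hE (ρ ≫ ω) θ σ
      rw [Category.assoc ρ] at h2
      rw [← h2]
      refine (mk_comp_congr h1.symm (mk_pull_pull ρ ω (comparison hE θ σ)).symm).trans ?_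
      refine Eq.trans ?_ (mk_comp_congr rfl (mk_map_congr _ (mk_cast_right e _).symm))
      rw [Category.assoc, ← CategoryTheory.Functor.map_comp]
      rfl
    rw [h]
    exact mk_cast_right _ _

end Companion

/-! ### The vertical simplicially enriched category -/

section Vertical

open MonoidalCategory

/-- The action of `θ` on the simplices of the mapping spaces of `𝔼ᵥ`. -/
def vertMap {m n : ℕ} (θ : ⦋m⦌ ⟶ ⦋n⦌) {x y : Lev E 0} (f : (dg E n).obj x ⟶ (dg E n).obj y) :
    (dg E m).obj x ⟶ (dg E m).obj y :=
  eqToHom (dg_obj_eq θ x).symm ≫ (pull θ).map f ≫ eqToHom (dg_obj_eq θ y)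

theorem mk_vertMap {m n : ℕ} (θ : ⦋m⦌ ⟶ ⦋n⦌) {x y : Lev E 0}
    (f : (dg E n).obj x ⟶ (dg E n).obj y) :
    Arrow.mk (vertMap θ f) = Arrow.mk ((pull θ).map f) :=
  mk_cast _ _ _

theorem vertMap_id {n : ℕ} {x y : Lev E 0} (f : (dg E n).obj x ⟶ (dg E n).obj y) :
    vertMap (𝟙 _) f = f :=
  mk_inj ((mk_vertMap _ _).trans (mk_pull_id f))

theorem vertMap_vertMap {k m n : ℕ} (ω : ⦋k⦌ ⟶ ⦋m⦌) (θ : ⦋m⦌ ⟶ ⦋n⦌) {x y : Lev E 0}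
    (f : (dg E n).obj x ⟶ (dg E n).obj y) :
    vertMap ω (vertMap θ f) = vertMap (ω ≫ θ) f :=
  mk_inj ((mk_vertMap _ _).trans ((mk_map_congr _ (mk_vertMap _ _)).trans
    ((mk_pull_pull _ _ _).trans (mk_vertMap _ _).symm)))

theorem vertMap_identity {m n : ℕ} (θ : ⦋m⦌ ⟶ ⦋n⦌) (x : Lev E 0) :
    vertMap θ (𝟙 ((dg E n).obj x)) = 𝟙 _ := by
  simp [vertMap]

theorem vertMap_comp {m n : ℕ} (θ : ⦋m⦌ ⟶ ⦋n⦌) {x y z : Lev E 0}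
    (f : (dg E n).obj x ⟶ (dg E n).obj y) (g : (dg E n).obj y ⟶ (dg E n).obj z) :
    vertMap θ (f ≫ g) = vertMap θ f ≫ vertMap θ g := by
  simp [vertMap]

theorem vertMap_dg {m n : ℕ} (θ : ⦋m⦌ ⟶ ⦋n⦌) {x y : Lev E 0} (f : x ⟶ y) :
    vertMap θ ((dg E n).map f) = (dg E m).map f :=
  mk_inj ((mk_vertMap _ _).trans (mk_pull_dg _ _))

/-- The mapping space `𝔼ᵥ(x, y)`, with `𝔼ᵥ(x, y)ₙ = 𝔼ₙ(sⁿ x, sⁿ y)`. -/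
def vertHom (x y : Lev E 0) : SSet.{v} where
  obj Δ := (dg E Δ.unop.len).obj x ⟶ (dg E Δ.unop.len).obj y
  map θ := ↾fun f => vertMap θ.unop f
  map_id Δ := by ext f; exact vertMap_id f
  map_comp θ ω := by ext f; exact (vertMap_vertMap _ _ f).symm

/-- The `sSet`-enriched category `𝔼ᵥ`, with underlying category `𝔼₀`. -/
instance vertical : SimplicialCategory (Lev E 0) where
  Hom := vertHom
  id x :=
    { app Δ := ↾fun _ => 𝟙 ((dg E Δ.unop.len).obj x)
      naturality _ _ θ := by ext _; exact (vertMap_identity θ.unop x).symm }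
  comp x y z :=
    { app Δ := ↾fun f => (f.1 ≫ f.2 : (dg E Δ.unop.len).obj x ⟶ (dg E Δ.unop.len).obj z)
      naturality _ _ θ := by ext f; exact (vertMap_comp θ.unop f.1 f.2).symm }
  id_comp x y := by ext Δ f; exact Category.id_comp (obj := Lev E Δ.unop.len) _
  comp_id x y := by ext Δ f; exact Category.comp_id (obj := Lev E Δ.unop.len) _
  assoc x y z w := by
    ext Δ f
    exact Category.assoc (obj := Lev E Δ.unop.len) _ _ _
  homEquiv {x y} :=
    { toFun f :=
        { app Δ := ↾fun _ => (dg E Δ.unop.len).map f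
          naturality _ _ θ := by ext _; exact (vertMap_dg θ.unop f).symm }
      invFun g := eqToHom (dg_zero_obj x).symm ≫ (g.app (op ⦋0⦌) PUnit.unit :
        (dg E 0).obj x ⟶ (dg E 0).obj y) ≫ eqToHom (dg_zero_obj y)
      left_inv f := mk_inj ((mk_cast _ _ _).trans (mk_dg_zero f))
      right_inv g := by
        ext Δ a
        have h := NatTrans.naturality_apply g (SimplexCategory.const Δ.unop ⦋0⦌ 0).op PUnit.unit
        refine Eq.trans ?_ h.symm
        exact mk_inj ((mk_map_congr _ (mk_cast _ _ _)).trans (mk_vertMap _ _).symm) }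
  homEquiv_id x := by
    ext Δ a
    exact (dg E Δ.unop.len).map_id x
  homEquiv_comp f g := by
    ext Δ a
    exact (dg E Δ.unop.len).map_comp f g

end Vertical

/-! ### Tensors and homotopy colimits in simplicially enriched categories -/

section Hocolim

variable {C : Type u} [Category.{v} C] [SimplicialCategory C]

/-- A tensor `K ⊙ x` in an `sSet`-category: an object with natural bijections
`C₀(K ⊙ x, y) ≅ sSet(K, C(x, y))`. -/
structure Tensor (K : SSet.{v}) (x : C) where
  /-- the object `K ⊙ x` -/
  obj : C
  /-- the natural bijections `C₀(K ⊙ x, y) ≅ sSet(K, C(x, y))` -/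
  corep : ((eHomFunctor SSet.{v} C).obj (op x) ⋙ coyoneda.obj (op K)).CorepresentableBy obj

namespace Tensor

/-- The bijection `C₀(K ⊙ x, y) ≅ sSet(K, C(x, y))`. -/
def equiv {K : SSet.{v}} {x : C} (t : Tensor K x) {y : C} :
    (t.obj ⟶ y) ≃ (K ⟶ (x ⟶[SSet.{v}] y)) := t.corep.homEquiv

theorem equiv_comp {K : SSet.{v}} {x : C} (t : Tensor K x) {y y' : C} (f : t.obj ⟶ y)
    (g : y ⟶ y') : t.equiv (f ≫ g) = t.equiv f ≫ eHomWhiskerLeft SSet.{v} x g :=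
  t.corep.homEquiv_comp g f

/-- The functoriality of `K ⊙ x` in `K` and `x`. -/
def map {K K' : SSet.{v}} {x x' : C} (t : Tensor K x) (t' : Tensor K' x') (a : K ⟶ K')
    (f : x ⟶ x') : t.obj ⟶ t'.obj :=
  t.equiv.symm (a ≫ t'.equiv (𝟙 _) ≫ eHomWhiskerRight SSet.{v} f t'.obj)

theorem equiv_map_comp {K K' : SSet.{v}} {x x' y : C} (t : Tensor K x) (t' : Tensor K' x')
    (a : K ⟶ K') (f : x ⟶ x') (g : t'.obj ⟶ y) :
    t.equiv (t.map t' a f ≫ g) = a ≫ t'.equiv g ≫ eHomWhiskerRight SSet.{v} f y := by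
  rw [equiv_comp, map, Equiv.apply_symm_apply, Category.assoc, Category.assoc,
    ← eHom_whisker_exchange, ← Category.assoc (t'.equiv (𝟙 _)), ← equiv_comp, Category.id_comp]

theorem map_id {K : SSet.{v}} {x : C} (t : Tensor K x) : t.map t (𝟙 _) (𝟙 _) = 𝟙 _ := by
  simp [map]

theorem map_comp {K K' K'' : SSet.{v}} {x x' x'' : C} (t : Tensor K x) (t' : Tensor K' x')
    (t'' : Tensor K'' x'') (a : K ⟶ K') (f : x ⟶ x') (b : K' ⟶ K'') (g : x' ⟶ x'') :
    t.map t' a f ≫ t'.map t'' b g = t.map t'' (a ≫ b) (f ≫ g) := by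
  apply t.equiv.injective
  rw [equiv_map_comp, map, map, Equiv.apply_symm_apply, Equiv.apply_symm_apply]
  simp

end Tensor

/-- The bifunctor `(i, j) ↦ W(i) ⊙ F(j)`. -/
def tensorBifunctor {J : Type w} [Category.{v} J] (W : Jᵒᵖ ⥤ SSet.{v}) (F : J ⥤ C)
    (t : ∀ i j : J, Tensor (W.obj (op i)) (F.obj j)) : Jᵒᵖ ⥤ J ⥤ C where
  obj i :=
    { obj j := (t i.unop j).obj
      map {j j'} g := (t i.unop j).map (t i.unop j') (𝟙 _) (F.map g)
      map_id j := by rw [CategoryTheory.Functor.map_id, Tensor.map_id]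
      map_comp g g' := by rw [Tensor.map_comp, Category.comp_id, CategoryTheory.Functor.map_comp] }
  map {i i'} f :=
    { app j := (t i.unop j).map (t i'.unop j) (W.map f) (𝟙 _)
      naturality j j' g := by
        dsimp only
        rw [Tensor.map_comp, Tensor.map_comp]
        simp }
  map_id i := by
    ext j
    exact (congrArg (fun a => (t i.unop j).map (t i.unop j) a (𝟙 _)) (W.map_id i)).trans
      (Tensor.map_id _)
  map_comp {i i' i''} f f' := by
    ext j
    refine Eq.trans ?_ (Tensor.map_comp (t i.unop j) (t i'.unop j) (t i''.unop j) _ _ _ _).symm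
    dsimp only
    rw [W.map_comp, Category.comp_id]

/-- The weight `i ↦ N(i/J)`. -/
def hocolimWeight (J : Type v) [SmallCategory J] : Jᵒᵖ ⥤ SSet.{v} :=
  Under.mapFunctor J ⋙ nerveFunctor

/-- The bifunctor `(i, j) ↦ (i/J) ⊙ F(j)`; the homotopy colimit of `F` is its coend. -/
def hocolimBifunctor {J : Type v} [SmallCategory J] (F : J ⥤ C)
    (t : ∀ i j : J, Tensor ((hocolimWeight J).obj (op i)) (F.obj j)) : Jᵒᵖ ⥤ J ⥤ C :=
  tensorBifunctor (hocolimWeight J) F t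

end Hocolim

section Comparison

variable (hE : IsHigherEquipment E) {J : Type v} [SmallCategory J] {F : J ⥤ Lev E 0}

/-- A cocone `η : F^* ⇒ x` gives, for each `n`-simplex `τ = (i ⟶ j₀ ⟶ ⋯ ⟶ jₙ)` of `i/J`, the
`n`-simplex `sⁿ F(i) ⟶ sⁿ F(j₀) ⟶ F^*(j₀ ⟶ ⋯ ⟶ jₙ) ⟶ sⁿ x` of `𝔼ᵥ(F(i), x)`. -/
noncomputable def coconeSimplex {x : Lev E 0} (c : ((companionDiagram hE).precomp F).Cocone x)
    {i : J} {n : ℕ} (τ : ComposableArrows (Under i) n) :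
    (dg E n).obj (F.obj i) ⟶ (dg E n).obj x :=
  (dg E n).map (F.map (τ.obj 0).hom) ≫ phi hE ((τ ⋙ Under.forget i) ⋙ F) ≫
    c.η (τ ⋙ Under.forget i)

/-- A cowedge from `(i/J) ⊙ F(i)` to `x` gives for each `n`-simplex `τ` of `i/J` an `n`-simplex of
`𝔼ᵥ(F(i), x)`. -/
def cowedgeSimplex {t : ∀ i j : J, Tensor ((hocolimWeight J).obj (op i)) (F.obj j)}
    (c : Limits.Cowedge (hocolimBifunctor F t)) {i : J} {n : ℕ}
    (τ : ComposableArrows (Under i) n) :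
    (dg E n).obj (F.obj i) ⟶ (dg E n).obj (c.pt : Lev E 0) :=
  ((t i i).equiv (c.π i)).app (op ⦋n⦌) τ

end Comparison

end HigherEquipment

namespace HigherEquipment

variable {E : SimplicialObject Cat.{v, u}}

/-! ### Simplex families: the common form of cocones and cowedges -/

/-- A compatible family of maps `sⁿ F(j₀) ⟶ sⁿ x`, one for each `n`-simplex `j₀ ⟶ ⋯ ⟶ jₙ` of the
nerve of `J`. -/
@[ext]
structure SimplexFamily {J : Type w} [Category.{v} J] (F : J ⥤ Lev E 0) (x : Lev E 0) where
  /-- the component at an `n`-simplex -/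
  app {n : ℕ} (σ : ComposableArrows J n) : (dg E n).obj (F.obj (σ.obj 0)) ⟶ (dg E n).obj x
  naturality {m n : ℕ} (θ : ⦋m⦌ ⟶ ⦋n⦌) (σ : ComposableArrows J n) :
    vertMap θ (app σ) = (dg E m).map (F.map (first θ σ)) ≫ app (reindex θ σ)

theorem SimplexFamily.vertMap_comp_app {J : Type w} [Category.{v} J] {F : J ⥤ Lev E 0}
    {x : Lev E 0} (s : SimplexFamily F x) {m n : ℕ} (θ : ⦋m⦌ ⟶ ⦋n⦌) {i : J}
    {σ : ComposableArrows J n} (a : i ⟶ σ.obj 0) :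
    vertMap θ ((dg E n).map (F.map a) ≫ s.app σ) =
      (dg E m).map (F.map (a ≫ first θ σ)) ≫ s.app (reindex θ σ) := by
  rw [vertMap_comp, vertMap_dg, s.naturality, ← Category.assoc, ← Functor.map_comp,
    ← Functor.map_comp]

/-- A simplex family is universal if every other one factors uniquely through it. -/
def SimplexFamily.IsUniversal {J : Type w} [Category.{v} J] {F : J ⥤ Lev E 0} {x : Lev E 0}
    (s : SimplexFamily F x) : Prop :=
  ∀ (x' : Lev E 0) (s' : SimplexFamily F x'), ∃! f : x ⟶ x',
    ∀ (n : ℕ) (σ : ComposableArrows J n), s.app σ ≫ (dg E n).map f = s'.app σ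

theorem SimplexFamily.IsUniversal.exists_iso {J : Type w} [Category.{v} J] {F : J ⥤ Lev E 0}
    {x x' : Lev E 0} {s : SimplexFamily F x} {s' : SimplexFamily F x'} (hs : s.IsUniversal)
    (hs' : s'.IsUniversal) : ∃ e : x ≅ x', ∀ (n : ℕ) (σ : ComposableArrows J n),
      s.app σ ≫ (dg E n).map e.hom = s'.app σ := by
  obtain ⟨f, hf, -⟩ := hs x' s'
  obtain ⟨g, hg, -⟩ := hs' x s
  refine ⟨⟨f, g, (hs x s).unique (fun n σ => ?_) (fun n σ => ?_),
    (hs' x' s').unique (fun n σ => ?_) (fun n σ => ?_)⟩, hf⟩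
  · rw [Functor.map_comp, ← Category.assoc, hf, hg]
  · rw [CategoryTheory.Functor.map_id, Category.comp_id]
  · rw [Functor.map_comp, ← Category.assoc, hg, hf]
  · rw [CategoryTheory.Functor.map_id, Category.comp_id]

/-! ### Cocones as simplex families -/

section Cocone

variable (hE : IsHigherEquipment E) {J : Type w} [Category.{v} J] {F : J ⥤ Lev E 0} {x : Lev E 0}

theorem mk_phi_comparison {m n : ℕ} (θ : ⦋m⦌ ⟶ ⦋n⦌) (σ : ComposableArrows (Lev E 0) n) :
    Arrow.mk (phi hE (reindex θ σ) ≫ comparison hE θ σ) = Arrow.mk (kappa hE θ σ) := by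
  refine (mk_comp_congr (mk_kappa_id hE _).symm (mk_pull_id _).symm).trans
    ((mk_kappa_comparison hE (𝟙 _) θ σ).trans ?_)
  rw [Category.id_comp θ]

/-- The composites of `kappa` with the components of a cocone. -/
theorem mk_kappa_cocone (c : ((companionDiagram hE).precomp F).Cocone x) {m n : ℕ}
    (θ : ⦋m⦌ ⟶ ⦋n⦌) (σ : ComposableArrows J n) :
    Arrow.mk (kappa hE θ (σ ⋙ F) ≫ (pull θ).map (c.η σ)) =
      Arrow.mk (phi hE (reindex θ σ ⋙ F) ≫ c.η (reindex θ σ)) := by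
  refine (mk_comp_congr (mk_phi_comparison hE θ (σ ⋙ F)).symm rfl).trans ?_
  rw [Category.assoc]
  exact mk_comp_congr rfl (c.naturality θ σ)

/-- The simplex family `φ ≫ η` of a cocone `η`. -/
noncomputable def coconeFamily (c : ((companionDiagram hE).precomp F).Cocone x) :
    SimplexFamily F x where
  app σ := phi hE (σ ⋙ F) ≫ c.η σ
  naturality {m n} θ σ := by
    apply mk_inj
    refine (mk_vertMap _ _).trans ((congrArg Arrow.mk ((pull θ).map_comp (phi hE (σ ⋙ F))
      (c.η σ))).trans ((mk_comp_congr (mk_pull_phi hE θ (σ ⋙ F)) rfl).trans ?_))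
    rw [Category.assoc]
    exact mk_comp_congr rfl (mk_kappa_cocone hE c θ σ)

theorem cocone_hom_ext (c : ((companionDiagram hE).precomp F).Cocone x) {n : ℕ}
    (σ : ComposableArrows J n) {k : companion hE (σ ⋙ F) ⟶ (dg E n).obj x}
    (hk : ∀ (m : ℕ) (θ : ⦋m⦌ ⟶ ⦋n⦌), Arrow.mk (kappa hE θ (σ ⋙ F) ≫ (pull θ).map k) =
      Arrow.mk ((coconeFamily hE c).app (reindex θ σ))) : c.η σ = k :=
  companion_hom_ext hE fun m θ => mk_inj ((mk_kappa_cocone hE c θ σ).trans (hk m θ).symm)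

theorem exists_coconeFamily_eq (s : SimplexFamily F x) :
    ∃ c : ((companionDiagram hE).precomp F).Cocone x, coconeFamily hE c = s := by
  have key {n : ℕ} (σ : ComposableArrows J n) : ∃ k : companion hE (σ ⋙ F) ⟶ (dg E n).obj x,
      ∀ {m : ℕ} (ω : ⦋m⦌ ⟶ ⦋n⦌), Arrow.mk (kappa hE ω (σ ⋙ F) ≫ (pull ω).map k) =
        Arrow.mk (s.app (reindex ω σ)) := by
    obtain ⟨k, hk⟩ := exists_companion_desc hE (σ ⋙ F) ((dg E n).obj x)
      (fun ω => s.app (reindex ω σ) ≫ eqToHom (dg_obj_eq ω x).symm) (by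
        intro k m ω' ω
        refine (mk_map_congr _ (mk_cast_right _ _)).trans ((mk_vertMap _ _).symm.trans ?_)
        rw [s.naturality]
        exact mk_comp_congr rfl (mk_cast_right _ _).symm)
    exact ⟨k, fun ω => by rw [hk]; exact mk_cast_right _ _⟩
  choose η hη using @key
  refine ⟨⟨fun σ => η σ, fun {m n} θ σ => ?_⟩, ?_⟩
  · have e := dg_obj_eq θ x
    have h : comparison hE θ (σ ⋙ F) ≫ (pull θ).map (η σ) ≫ eqToHom e = η (reindex θ σ) := by
      refine companion_hom_ext hE (σ := reindex θ σ ⋙ F) (fun l ω => mk_inj ?_)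
      refine Eq.trans ?_ (hη (reindex θ σ) ω).symm
      refine Eq.trans ?_ (hη σ (ω ≫ θ))
      refine Eq.trans ?_ (mk_comp_congr (mk_kappa_comparison hE ω θ (σ ⋙ F))
        (mk_pull_pull ω θ (η σ)))
      rw [Category.assoc]
      refine mk_comp_congr rfl ((congrArg Arrow.mk ((pull ω).map_comp (comparison hE θ (σ ⋙ F))
        ((pull θ).map (η σ) ≫ eqToHom e))).trans ?_)
      exact mk_comp_congr rfl (mk_map_congr _ (mk_cast_right _ _))
    refine Eq.trans ?_ (congrArg Arrow.mk h)
    exact mk_comp_congr rfl (mk_cast_right _ _).symm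
  · ext n σ
    apply mk_inj
    refine (mk_comp_congr (mk_kappa_id hE _).symm (mk_pull_id _).symm).trans (hη σ (𝟙 _))

theorem coconeFamily_comp_iff (c : ((companionDiagram hE).precomp F).Cocone x) {x' : Lev E 0}
    (c' : ((companionDiagram hE).precomp F).Cocone x') (f : x ⟶ x') :
    (∀ (n : ℕ) (σ : ComposableArrows J n),
      (coconeFamily hE c).app σ ≫ (dg E n).map f = (coconeFamily hE c').app σ) ↔
    ∀ (n : ℕ) (σ : ComposableArrows J n), c.η σ ≫ (dg E n).map f = c'.η σ := by
  refine ⟨fun h n σ => (cocone_hom_ext hE c' σ fun m θ => ?_).symm, fun h n σ => ?_⟩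
  · rw [← h]
    refine (mk_comp_congr rfl (congrArg Arrow.mk ((pull θ).map_comp (c.η σ)
      ((dg E n).map f)))).trans ?_
    refine (congrArg Arrow.mk (Category.assoc _ _ _)).symm.trans ?_
    exact mk_comp_congr (mk_kappa_cocone hE c θ σ) (mk_pull_dg θ f)
  · refine (Category.assoc _ _ _).trans ?_
    exact congrArg (phi hE (σ ⋙ F) ≫ ·) (h n σ)

theorem coconeFamily_isUniversal_iff (c : ((companionDiagram hE).precomp F).Cocone x) :
    (coconeFamily hE c).IsUniversal ↔ c.IsDoubleColimit := by
  refine ⟨fun h x' c' => ?_, fun h x' s' => ?_⟩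
  · simpa only [coconeFamily_comp_iff] using h x' (coconeFamily hE c')
  · obtain ⟨c', rfl⟩ := exists_coconeFamily_eq hE s'
    simpa only [coconeFamily_comp_iff] using h x' c'

end Cocone

/-! ### Cowedges as simplex families -/

/-- The `n`-simplex `j₀ ⟶ ⋯ ⟶ jₙ` as a simplex of `j₀/J`. -/
def underLift {J : Type w} [Category.{v} J] {n : ℕ} (σ : ComposableArrows J n) :
    ComposableArrows (Under (σ.obj 0)) n where
  obj k := Under.mk (σ.map (homOfLE (Fin.zero_le k)))
  map f := Under.homMk (σ.map f) (by
    dsimp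
    rw [← σ.map_comp]; rfl)

theorem underLift_comp_map {J : Type w} [Category.{v} J] {i : J} {n : ℕ}
    (τ : ComposableArrows (Under i) n) :
    underLift (τ ⋙ Under.forget i) ⋙ Under.map (τ.obj 0).hom = τ := by
  have e (k : Fin (n + 1)) :
      (underLift (τ ⋙ Under.forget i) ⋙ Under.map (τ.obj 0).hom).obj k = τ.obj k := by
    change Under.mk ((τ.obj 0).hom ≫ (τ.map (homOfLE (Fin.zero_le k))).right) = τ.obj k
    rw [Under.w]
    rfl
  refine CategoryTheory.Functor.ext e fun k l f => ?_
  ext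
  have e' {X Y : Under i} (h : X = Y) : (eqToHom h).right =
      eqToHom (congrArg Comma.right h) := by subst h; rfl
  rw [Under.comp_right, Under.comp_right, e', e']
  exact ((Category.id_comp _).trans (Category.comp_id _)).symm

section Cowedge

open Limits

variable {J : Type v} [SmallCategory J] {F : J ⥤ Lev E 0}
  {t : ∀ i j : J, Tensor ((hocolimWeight J).obj (op i)) (F.obj j)}

theorem equiv_ext {K : SSet.{v}} {x y : Lev E 0} (t : Tensor K x) {f g : t.obj ⟶ y}
    (h : ∀ (n : ℕ) (k : K.obj (op ⦋n⦌)),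
      (t.equiv f).app (op ⦋n⦌) k = (t.equiv g).app (op ⦋n⦌) k) : f = g := by
  apply t.equiv.injective
  ext Δ k
  exact h Δ.unop.len k

/-- The compatibility conditions of a cowedge on `(i/J) ⊙ F(i)`, in terms of simplices. -/
theorem hocolimBifunctor_condition_iff {x : Lev E 0}
    (π : ∀ i : J, ((hocolimBifunctor F t).obj (op i)).obj i ⟶ x) {i j : J} (f : i ⟶ j) :
    ((hocolimBifunctor F t).map f.op).app i ≫ π i =
        ((hocolimBifunctor F t).obj (op j)).map f ≫ π j ↔
      ∀ (n : ℕ) (τ : ComposableArrows (Under j) n),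
        (((t i i).equiv (π i)).app (op ⦋n⦌) (τ ⋙ Under.map f : ComposableArrows (Under i) n) :
          (dg E n).obj (F.obj i) ⟶ (dg E n).obj x) =
        (dg E n).map (F.map f) ≫ (((t j j).equiv (π j)).app (op ⦋n⦌) τ :
          (dg E n).obj (F.obj j) ⟶ (dg E n).obj x) := by
  have h₁ : (t j i).equiv (((hocolimBifunctor F t).map f.op).app i ≫ π i) =
      (hocolimWeight J).map f.op ≫ (t i i).equiv (π i) := by
    refine (Tensor.equiv_map_comp (t j i) (t i i) _ _ (π i)).trans ?_
    rw [eHomWhiskerRight_id, Category.comp_id]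
  have h₂ : (t j i).equiv (((hocolimBifunctor F t).obj (op j)).map f ≫ π j) =
      (t j j).equiv (π j) ≫ eHomWhiskerRight SSet.{v} (F.map f) x := by
    refine (Tensor.equiv_map_comp (t j i) (t j j) _ _ (π j)).trans ?_
    rw [Category.id_comp]
  refine (t j i).equiv.injective.eq_iff.symm.trans ((Eq.congr h₁ h₂).trans
    ⟨fun h n τ => ?_, fun h => ?_⟩)
  · exact ConcreteCategory.congr_hom (NatTrans.congr_app h (op ⦋n⦌)) τ
  · ext Δ τ
    exact h Δ.unop.len τ

theorem cowedgeSimplex_map (c : Cowedge (hocolimBifunctor F t)) {i j : J} (f : i ⟶ j) {n : ℕ}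
    (τ : ComposableArrows (Under j) n) :
    cowedgeSimplex c (τ ⋙ Under.map f : ComposableArrows (Under i) n) =
      (dg E n).map (F.map f) ≫ cowedgeSimplex c τ :=
  (hocolimBifunctor_condition_iff (F := F) (t := t) (x := c.pt) (fun i => c.π i) f).1 (Cowedge.condition c f) n τ

theorem cowedgeSimplex_eq (c : Cowedge (hocolimBifunctor F t)) {i : J} {n : ℕ}
    (τ : ComposableArrows (Under i) n) :
    cowedgeSimplex c τ = (dg E n).map (F.map (τ.obj 0).hom) ≫
      cowedgeSimplex c (underLift (τ ⋙ Under.forget i)) := by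
  conv_lhs => rw [← underLift_comp_map τ]
  exact cowedgeSimplex_map c _ _

/-- The simplex family of a cowedge on `(i/J) ⊙ F(i)`. -/
def cowedgeFamily (c : Cowedge (hocolimBifunctor F t)) : SimplexFamily F c.pt where
  app σ := cowedgeSimplex c (underLift σ)
  naturality {m n} θ σ := by
    have h := NatTrans.naturality_apply ((t (σ.obj 0) (σ.obj 0)).equiv (c.π (σ.obj 0))) θ.op
      (underLift σ)
    exact h.symm.trans (cowedgeSimplex_eq c (reindex θ (underLift σ)))

/-- The map `N(i/J) ⟶ 𝔼ᵥ(F(i), x)` given by a simplex family. -/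
def SimplexFamily.weightMap {x : Lev E 0} (s : SimplexFamily F x) (i : J) :
    (hocolimWeight J).obj (op i) ⟶ vertHom (F.obj i) x where
  app Δ := ↾fun (τ : ComposableArrows (Under i) Δ.unop.len) =>
    (dg E Δ.unop.len).map (F.map (τ.obj 0).hom) ≫ s.app (τ ⋙ Under.forget i)
  naturality Δ Δ' θ := by
    ext (τ : ComposableArrows (Under i) Δ.unop.len)
    have h : (τ.obj 0).hom ≫ first θ.unop (τ ⋙ Under.forget i) =
      ((reindex θ.unop τ).obj 0).hom := Under.w (first θ.unop τ)
    refine Eq.trans ?_ (s.vertMap_comp_app θ.unop (σ := τ ⋙ Under.forget i) (τ.obj 0).hom).symm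
    exact congrArg (fun a => (dg E Δ'.unop.len).map (F.map a) ≫
      s.app (reindex θ.unop (τ ⋙ Under.forget i))) h.symm

/-- The cowedge on `(i/J) ⊙ F(i)` given by a simplex family. -/
def SimplexFamily.cowedge {x : Lev E 0} (s : SimplexFamily F x)
    (t : ∀ i j : J, Tensor ((hocolimWeight J).obj (op i)) (F.obj j)) :
    Cowedge (hocolimBifunctor F t) :=
  Cowedge.mk x (fun i => (t i i).equiv.symm (s.weightMap i))
    (fun i j f => (hocolimBifunctor_condition_iff (F := F) (t := t) (x := x)
      (fun i => (t i i).equiv.symm (s.weightMap i)) f).2 fun n τ => by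
        rw [Equiv.apply_symm_apply, Equiv.apply_symm_apply]
        refine Eq.trans ?_ (Category.assoc _ _ _)
        rw [← Functor.map_comp, ← Functor.map_comp]
        rfl)

theorem SimplexFamily.cowedgeFamily_cowedge {x : Lev E 0} (s : SimplexFamily F x)
    (t : ∀ i j : J, Tensor ((hocolimWeight J).obj (op i)) (F.obj j)) :
    cowedgeFamily (s.cowedge t) = s := by
  refine SimplexFamily.ext ?_
  funext n σ
  have h : (t (σ.obj 0) (σ.obj 0)).equiv ((s.cowedge t).π (σ.obj 0)) = s.weightMap (σ.obj 0) :=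
    (t _ _).equiv.apply_symm_apply _
  refine (ConcreteCategory.congr_hom (NatTrans.congr_app h (op ⦋n⦌)) (underLift σ)).trans ?_
  change (dg E n).map (F.map (σ.map (𝟙 _))) ≫ s.app σ = s.app σ
  simp only [CategoryTheory.Functor.map_id, Category.id_comp]

theorem cowedgeSimplex_comp_eq (c : Cowedge (hocolimBifunctor F t)) {x : Lev E 0} (f : c.pt ⟶ x)
    {i : J} {n : ℕ} (τ : ComposableArrows (Under i) n) :
    (((t i i).equiv (c.π i ≫ f)).app (op ⦋n⦌) τ : (dg E n).obj (F.obj i) ⟶ (dg E n).obj x) =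
      cowedgeSimplex c τ ≫ (dg E n).map f :=
  ConcreteCategory.congr_hom (NatTrans.congr_app ((t i i).equiv_comp (c.π i) f) (op ⦋n⦌)) τ

theorem cowedgeFamily_comp_iff (c c' : Cowedge (hocolimBifunctor F t)) (f : c.pt ⟶ c'.pt) :
    (∀ (n : ℕ) (σ : ComposableArrows J n),
      (cowedgeFamily c).app σ ≫ (dg E n).map f = (cowedgeFamily c').app σ) ↔
    ∀ i : J, c.π i ≫ f = c'.π i := by
  refine ⟨fun h i => equiv_ext (t i i) fun n τ => ?_, fun h n σ => ?_⟩
  · refine (cowedgeSimplex_comp_eq c f τ).trans (Eq.trans ?_ (cowedgeSimplex_eq c' τ).symm)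
    rw [cowedgeSimplex_eq c τ, Category.assoc]
    exact congrArg ((dg E n).map (F.map (τ.obj 0).hom) ≫ ·) (h n (τ ⋙ Under.forget i))
  · refine (cowedgeSimplex_comp_eq c f (underLift σ)).symm.trans ?_
    exact congrArg (fun g => ((t _ _).equiv g).app (op ⦋n⦌) (underLift σ)) (h (σ.obj 0))

theorem cowedgeFamily_isUniversal_iff (c : Cowedge (hocolimBifunctor F t)) :
    (cowedgeFamily c).IsUniversal ↔ Nonempty (IsColimit c) := by
  refine ⟨fun h => ?_, fun ⟨hc⟩ x' s' => ?_⟩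
  · have key (c' : Cowedge (hocolimBifunctor F t)) :
        ∃! f : c.pt ⟶ c'.pt, ∀ i : J, c.π i ≫ f = c'.π i := by
      simpa only [cowedgeFamily_comp_iff] using h c'.pt (cowedgeFamily c')
    exact ⟨Multicofork.IsColimit.mk c (fun c' => (key c').choose)
      (fun c' i => (key c').choose_spec.1 i)
      (fun c' f hf => (key c').choose_spec.2 f hf)⟩
  · have key : ∃! f : c.pt ⟶ (s'.cowedge t).pt, ∀ i : J, c.π i ≫ f = (s'.cowedge t).π i :=
      ⟨Cowedge.IsColimit.desc hc (s'.cowedge t).π fun _ _ g => Cowedge.condition _ g,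
        fun i => Cowedge.IsColimit.π_desc hc _ _ i, fun g hg =>
          Cowedge.IsColimit.hom_ext hc fun i =>
            (hg i).trans (Cowedge.IsColimit.π_desc hc _ _ i).symm⟩
    simp only [← cowedgeFamily_comp_iff, s'.cowedgeFamily_cowedge t] at key
    exact key

end Cowedge

end HigherEquipment

open HigherEquipment in
theorem mainTheorem1 {E : SimplicialObject Cat.{v, u}} (hE : IsHigherEquipment E)
    {J : Type v} [SmallCategory J] (F : J ⥤ Lev E 0)
    (t : ∀ i j : J, Tensor ((hocolimWeight J).obj (op i)) (F.obj j)) :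
    ((∃ (x : Lev E 0) (η : ((companionDiagram hE).precomp F).Cocone x), η.IsDoubleColimit) ↔
      Limits.HasCoend (hocolimBifunctor F t)) ∧
    ∀ (x : Lev E 0) (η : ((companionDiagram hE).precomp F).Cocone x), η.IsDoubleColimit →
      ∀ (c : Limits.Cowedge (hocolimBifunctor F t)), Nonempty (Limits.IsColimit c) →
        ∃ e : x ≅ c.pt, ∀ (i : J) (n : ℕ) (τ : ComposableArrows (Under i) n),
          coconeSimplex hE η τ ≫ (dg E n).map e.hom = cowedgeSimplex c τ := by
  refine ⟨⟨fun ⟨x, η, h⟩ => ?_, fun h => ?_⟩, fun x η h c hc => ?_⟩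
  · have hη := (coconeFamily_isUniversal_iff hE η).2 h
    rw [← (coconeFamily hE η).cowedgeFamily_cowedge t] at hη
    obtain ⟨hc⟩ := (cowedgeFamily_isUniversal_iff _).1 hη
    exact ⟨⟨_, hc⟩⟩
  · have hs := (cowedgeFamily_isUniversal_iff (Limits.colimit.cocone
      (Limits.multispanIndexCoend (hocolimBifunctor F t)).multispan)).2
        ⟨Limits.colimit.isColimit _⟩
    obtain ⟨η, hη⟩ := exists_coconeFamily_eq hE (cowedgeFamily (Limits.colimit.cocone
      (Limits.multispanIndexCoend (hocolimBifunctor F t)).multispan))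
    exact ⟨_, η, (coconeFamily_isUniversal_iff hE η).1 (hη ▸ hs)⟩
  · obtain ⟨e, he⟩ := ((coconeFamily_isUniversal_iff hE η).2 h).exists_iso
      ((cowedgeFamily_isUniversal_iff c).2 hc)
    refine ⟨e, fun i n τ => ?_⟩
    rw [cowedgeSimplex_eq c τ]
    refine (Category.assoc _ _ _).trans ?_
    exact congrArg ((dg E n).map (F.map (τ.obj 0).hom) ≫ ·) (he n (τ ⋙ Under.forget i))
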